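/- Let $G$ be a totally disconnected, locally compact group and let $\alpha : G\to G$ be a continuous endomorphism. For a compact open subgroup $U$ of $G$ put $$U_+ = \{x\in U \mid \exists\, (x_n)_{n\in\mathbb{N}}\subseteq U \text{ with } x_0 = x \text{ and } \alpha(x_{n+1}) = x_n \text{ for every } n\in\mathbb{N}\},$$ $$U_- = \{x\in U \mid \alpha^n(x)\in U \text{ for every } n\in\mathbb{N}\},\qquad U_{++} = \bigcup_{n\ge 0}\alpha^n(U_+).$$ Call $U$ *minimizing* for $\alpha$ if its displacement index $[\alpha(U):\alpha(U)\cap U]$ (which is finite) is the least among the displacement indices $[\alpha(V):\alpha(V)\cap V]$ of all compact open subgroups $V$ of $G$. Call $U$ *tidy* for $\alpha$ if - (TA) $U = U_+U_-$; - (TB1) $U_{++}$ is closed in $G$; and - (TB2) the sequence of integers $\left([\alpha^{n+1}(U_+):\alpha^n(U_+)]\right)_{n\in\mathbb{N}}$ is constant. Then a compact open subgroup $U$ of $G$ is minimizing for $\alpha$ if and only if it is tidy for $\alpha$. Moreover, there exists a compact open subgroup of $G$ that is tidy for $\alpha$. -/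

import Mathlib

open scoped Pointwise

namespace TidyEnd

variable {G : Type*} [Group G]

/-- `IsRegressive α x s`: the sequence `s` is an `α`-regressive sequence for `x`. -/
def IsRegressive (α : G →* G) (x : G) (s : ℕ → G) : Prop :=
  s 0 = x ∧ ∀ n, α (s (n + 1)) = s n

/-- `U₊`: the elements of `U` having an `α`-regressive sequence contained in `U`. -/
def plus (α : G →* G) (U : Subgroup G) : Subgroup G where
  carrier := {x | x ∈ U ∧ ∃ s : ℕ → G, (∀ n, s n ∈ U) ∧ IsRegressive α x s}
  one_mem' := ⟨U.one_mem, fun _ => 1, fun _ => U.one_mem, rfl, fun _ => map_one α⟩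
  mul_mem' := by
    rintro x y ⟨hx, s, hs, hs0, hs1⟩ ⟨hy, t, ht, ht0, ht1⟩
    refine ⟨U.mul_mem hx hy, fun n => s n * t n, fun n => U.mul_mem (hs n) (ht n), ?_, ?_⟩
    · simp only [hs0, ht0]
    · intro n
      simp only [map_mul, hs1, ht1]
  inv_mem' := by
    rintro x ⟨hx, s, hs, hs0, hs1⟩
    refine ⟨U.inv_mem hx, fun n => (s n)⁻¹, fun n => U.inv_mem (hs n), ?_, ?_⟩
    · simp only [hs0]
    · intro n
      simp only [map_inv, hs1]

/-- `U₋`: the elements of `U` whose forward `α`-orbit stays in `U`. -/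
def minus (α : G →* G) (U : Subgroup G) : Subgroup G where
  carrier := {x | x ∈ U ∧ ∀ n : ℕ, α^[n] x ∈ U}
  one_mem' := ⟨U.one_mem, fun n => by simp only [iterate_map_one, U.one_mem]⟩
  mul_mem' := by
    rintro x y ⟨hx, hx'⟩ ⟨hy, hy'⟩
    refine ⟨U.mul_mem hx hy, fun n => ?_⟩
    rw [iterate_map_mul]
    exact U.mul_mem (hx' n) (hy' n)
  inv_mem' := by
    rintro x ⟨hx, hx'⟩
    refine ⟨U.inv_mem hx, fun n => ?_⟩
    rw [iterate_map_inv]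
    exact U.inv_mem (hx' n)

/-- The image subgroup `αⁿ(H)`. -/
def iterMap (α : G →* G) (n : ℕ) (H : Subgroup G) : Subgroup G :=
  (Subgroup.map α)^[n] H

/-- `U₊₊ = ⋃ₙ αⁿ(U₊)`. -/
def plusPlus (α : G →* G) (U : Subgroup G) : Set G :=
  ⋃ n : ℕ, (iterMap α n (plus α U) : Set G)

/-- The displacement index `[α(U) : α(U) ∩ U]`. For `U` compact and open and `α` continuous it is
finite, so that the value `0` (infinite index) does not occur. -/
noncomputable def displacementIndex (α : G →* G) (U : Subgroup G) : ℕ :=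
  (U.map α ⊓ U).relIndex (U.map α)

/-- The displacement index of `U` is the least one among those of all compact open subgroups. -/
def IsMinimizing [TopologicalSpace G] (α : G →* G) (U : Subgroup G) : Prop :=
  ∀ V : Subgroup G, IsCompact (V : Set G) → IsOpen (V : Set G) →
    displacementIndex α U ≤ displacementIndex α V

/-- Condition TA: `U = U₊U₋`. -/
def IsTidyAbove (α : G →* G) (U : Subgroup G) : Prop :=
  (U : Set G) = (plus α U : Set G) * (minus α U : Set G)

/-- Conditions TB1 and TB2: `U₊₊` is closed and the sequence of indices
`[αⁿ⁺¹(U₊) : αⁿ(U₊)]` is constant. For `U` compact and open and `α` continuous,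
`αⁿ(U₊) ≤ αⁿ⁺¹(U₊)` and these indices are finite. -/
def IsTidyBelow [TopologicalSpace G] (α : G →* G) (U : Subgroup G) : Prop :=
  IsClosed (plusPlus α U) ∧
    ∃ c : ℕ, ∀ n : ℕ, (iterMap α n (plus α U)).relIndex (iterMap α (n + 1) (plus α U)) = c

/-- A subgroup is tidy if it is tidy above and tidy below. -/
def IsTidy [TopologicalSpace G] (α : G →* G) (U : Subgroup G) : Prop :=
  IsTidyAbove α U ∧ IsTidyBelow α U

end TidyEnd

/-!
The displacement indices `[αⁿ(U) : αⁿ(U) ∩ U]` satisfy `d(αⁿ, U) ≤ d(α, U)ⁿ`, and for two compact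
open subgroups `U` and `V` the numbers `d(αⁿ, U)` and `d(αⁿ, V)` differ by at most a factor that
does not depend on `n`. Comparing growth rates, every `U` with `d(αⁿ, U) = d(α, U)ⁿ` for all `n` is
minimizing, and as soon as one such subgroup exists all minimizing subgroups have this property.
Both notions of the theorem are thereby compared with multiplicativity of the displacement index.

A tidy subgroup is multiplicative because `d(αⁿ, U) = [αⁿ(U₊) : U₊]` telescopes into constant
factors. Conversely, minimality of `U` among its subgroups `U ∩ α⁻¹(U) ∩ ⋯ ∩ α⁻ⁿ(U)` forces
`U = U₊U₋`, and multiplicativity then forces `αⁿ(U₊) ∩ U = U₊`, from which TB1 and TB2 follow.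

A multiplicative subgroup is obtained from a minimizing one. Let `ℒ` be the group of all elements
with a regressive sequence ending up in `U₊` and a forward orbit ending up in `U₋`. It is relatively
compact, so `{x | ℒx ⊆ Uℒ}` is a compact open monoid, hence a group, and it is multiplicative
because it contains `ℒ`.
-/

namespace TidyEnd

open Subgroup

section RelIndex

variable {G G' : Type*} [Group G] [Group G'] {H K L : Subgroup G}

theorem relIndex_le_relIndex_mul_relIndex (hHK : H.relIndex K ≠ 0) (hKL : K.relIndex L ≠ 0) :
    H.relIndex L ≤ H.relIndex K * K.relIndex L :=
  calc H.relIndex L ≤ (H ⊓ K).relIndex L :=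
        relIndex_le_of_le_left inf_le_left
          (relIndex_inf_ne_zero (relIndex_ne_zero_trans hHK hKL) hKL)
    _ = H.relIndex (K ⊓ L) * K.relIndex L := (relIndex_inf_mul_relIndex H K L).symm
    _ ≤ H.relIndex K * K.relIndex L :=
        Nat.mul_le_mul_right _ (relIndex_le_of_le_right inf_le_left hHK)

theorem relIndex_map_map_le (f : G →* G') (h : H.relIndex K ≠ 0) :
    (H.map f).relIndex (K.map f) ≤ H.relIndex K := by
  rw [← relIndex_comap]
  exact relIndex_le_of_le_left (le_comap_map f H) h

theorem relIndex_map_map_ne_zero (f : G →* G') (h : H.relIndex K ≠ 0) :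
    (H.map f).relIndex (K.map f) ≠ 0 := by
  rw [← relIndex_comap]
  exact mt (relIndex_eq_zero_of_le_left (le_comap_map f H)) h

theorem relIndex_map_map_of_ker_inf_le {f : G →* G'} (hHK : H ≤ K) (hker : f.ker ⊓ K ≤ H) :
    (H.map f).relIndex (K.map f) = H.relIndex K := by
  have h : (H.map f).comap f ⊓ K = H := by
    refine le_antisymm ?_ (le_inf (le_comap_map f H) hHK)
    intro x hxmem
    obtain ⟨⟨y, hy, hyx⟩, hx⟩ := mem_inf.1 hxmem
    have hker' : y⁻¹ * x ∈ f.ker := by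
      rw [MonoidHom.mem_ker, map_mul, map_inv, hyx, inv_mul_cancel]
    exact (mul_mem_cancel_left (H.inv_mem hy)).1
      (hker ⟨hker', K.mul_mem (K.inv_mem (hHK hy)) hx⟩)
  rw [← relIndex_comap, ← inf_relIndex_right, h]

theorem relIndex_eq_of_subset_mul (hKL : K ≤ L) (h : (L : Set G) ⊆ K * H) :
    H.relIndex K = H.relIndex L := by
  refine Nat.card_congr (Equiv.ofBijective (quotientSubgroupOfEmbeddingOfLE H hKL)
    ⟨(quotientSubgroupOfEmbeddingOfLE H hKL).injective, fun q => ?_⟩)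
  obtain ⟨⟨x, hx⟩, rfl⟩ := QuotientGroup.mk_surjective q
  obtain ⟨k, hk, y, hy, rfl⟩ := Set.mem_mul.1 (h hx)
  refine ⟨QuotientGroup.mk ⟨k, hk⟩, ?_⟩
  rw [quotientSubgroupOfEmbeddingOfLE_apply_mk]
  exact QuotientGroup.eq.2 (mem_subgroupOf.2 (by simpa using hy))

theorem subset_mul_of_relIndex_le (hKL : K ≤ L) (h0 : H.relIndex L ≠ 0)
    (h : H.relIndex L ≤ H.relIndex K) : (L : Set G) ⊆ K * H := by
  intro x hx
  have : Finite (L ⧸ H.subgroupOf L) := Nat.finite_of_card_ne_zero h0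
  obtain ⟨q, hq⟩ := ((quotientSubgroupOfEmbeddingOfLE H hKL).injective.bijective_of_nat_card_le
    h).surjective (QuotientGroup.mk ⟨x, hx⟩)
  obtain ⟨k, rfl⟩ := QuotientGroup.mk_surjective q
  rw [quotientSubgroupOfEmbeddingOfLE_apply_mk] at hq
  exact ⟨k, k.2, (k : G)⁻¹ * x, mem_subgroupOf.1 (QuotientGroup.eq.1 hq), mul_inv_cancel_left _ _⟩

theorem inf_le_of_relIndex_le (hHK : H ≤ K) (h0 : H.relIndex L ≠ 0)
    (h : H.relIndex L ≤ K.relIndex L) : K ⊓ L ≤ H := by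
  have hmul := relIndex_inf_mul_relIndex H K L
  rw [inf_eq_left.2 hHK, le_antisymm h (relIndex_le_of_le_left hHK h0)] at hmul
  exact relIndex_eq_one.1 ((mul_eq_right₀ (h0 ∘ (relIndex_eq_zero_of_le_left hHK ·))).1 hmul)

theorem exists_finite_subset_mul_of_relIndex_ne_zero (h : H.relIndex K ≠ 0) :
    ∃ F : Set G, F.Finite ∧ F ⊆ K ∧ (K : Set G) ⊆ F * H := by
  have : Finite (K ⧸ H.subgroupOf K) := Nat.finite_of_card_ne_zero h
  refine ⟨Set.range fun q : K ⧸ H.subgroupOf K => (q.out : G), Set.finite_range _,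
    Set.range_subset_iff.2 fun q => q.out.2, fun x hx => ?_⟩
  let q : K ⧸ H.subgroupOf K := QuotientGroup.mk ⟨x, hx⟩
  exact ⟨q.out, Set.mem_range_self q, (q.out : G)⁻¹ * x,
    mem_subgroupOf.1 (QuotientGroup.eq.1 (QuotientGroup.out_eq' q)), mul_inv_cancel_left _ _⟩

end RelIndex

theorem le_of_forall_pow_le_mul_pow {a b C : ℕ} (h : ∀ n, a ^ n ≤ C * b ^ n) : a ≤ b := by
  by_contra! hba
  have hb : 0 < b := Nat.pos_of_ne_zero fun hb => by simpa [hb, (hb ▸ hba).ne'] using h 1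
  have hquot : (1 : ℝ) < a / b := (one_lt_div (by exact_mod_cast hb)).2 (by exact_mod_cast hba)
  obtain ⟨n, hn⟩ := pow_unbounded_of_one_lt (C : ℝ) hquot
  rw [div_pow, lt_div_iff₀ (by positivity)] at hn
  exact (h n).not_gt (by exact_mod_cast hn)

section Topology

theorem image_iInter_of_antitone {X Y : Type*} [TopologicalSpace X] [T2Space X]
    [TopologicalSpace Y] [T1Space Y] {f : X → Y} (hf : Continuous f) {K : ℕ → Set X}
    (hK : Antitone K) (hKc : ∀ n, IsCompact (K n)) : f '' ⋂ n, K n = ⋂ n, f '' K n := by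
  refine Set.Subset.antisymm (Set.image_iInter_subset K f) fun y hy => ?_
  have hc : ∀ n, IsCompact (K n ∩ f ⁻¹' {y}) := fun n =>
    (hKc n).inter_right (isClosed_singleton.preimage hf)
  obtain ⟨x, hx⟩ := IsCompact.nonempty_iInter_of_sequence_nonempty_isCompact_isClosed
    (fun n => K n ∩ f ⁻¹' {y}) (fun n => Set.inter_subset_inter_left _ (hK n.le_succ))
    (fun n => Set.mem_iInter.1 hy n) (hc 0) (fun n => (hc n).isClosed)
  rw [Set.mem_iInter] at hx
  exact ⟨x, Set.mem_iInter.2 fun n => (hx n).1, (hx 0).2⟩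

variable {G : Type*} [Group G] [TopologicalSpace G] [IsTopologicalGroup G]

theorem iInter_mul_iInter_of_antitone [T2Space G] {K C : ℕ → Set G} (hK : Antitone K)
    (hC : Antitone C) (hKc : ∀ n, IsCompact (K n)) (hCc : ∀ n, IsCompact (C n)) :
    (⋂ n, K n) * ⋂ n, C n = ⋂ n, K n * C n := by
  have hprod : (⋂ n, K n) ×ˢ (⋂ n, C n) = ⋂ n, K n ×ˢ C n := by
    ext x
    simp only [Set.mem_prod, Set.mem_iInter, forall_and]
  simp only [← Set.image_mul_prod, hprod]
  exact image_iInter_of_antitone continuous_mul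
    (fun _ _ hmn => Set.prod_mono (hK hmn) (hC hmn)) fun n => (hKc n).prod (hCc n)

theorem relIndex_ne_zero_of_isOpen_of_isCompact {H K : Subgroup G} (hH : IsOpen (H : Set G))
    (hK : IsCompact (K : Set G)) : H.relIndex K ≠ 0 := by
  have : CompactSpace K := isCompact_iff_compactSpace.1 hK
  have : Finite (K ⧸ H.subgroupOf K) :=
    quotient_finite_of_isOpen _ (hH.preimage continuous_subtype_val)
  exact Nat.card_pos.ne'

theorem isClosed_of_isClosed_inf {H U : Subgroup G} (hU : IsOpen (U : Set G))
    (h : IsClosed ((H ⊓ U : Subgroup G) : Set G)) : IsClosed (H : Set G) := by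
  refine isClosed_of_closure_subset fun x hx => ?_
  obtain ⟨y, hyx, hyH⟩ := mem_closure_iff.1 hx {y | y⁻¹ * x ∈ U}
    (hU.preimage (by fun_prop)) (by simp [U.one_mem])
  have hcl : y⁻¹ * x ∈ H.topologicalClosure :=
    mul_mem (inv_mem (H.le_topologicalClosure hyH)) hx
  have hmem : y⁻¹ * x ∈ _root_.closure ((U : Set G) ∩ H) := hU.inter_closure ⟨hyx, hcl⟩
  rw [Set.inter_comm, ← coe_inf, h.closure_eq] at hmem
  exact (mul_mem_cancel_left (inv_mem hyH)).1 hmem.1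

theorem exists_le_of_isCompact_of_forall_exists_mem {H : Subgroup G}
    (hH : IsCompact (H : Set G)) {F : ℕ → Subgroup G} (hF : Monotone F)
    (hFc : ∀ n, IsClosed (F n : Set G)) (h : ∀ x ∈ H, ∃ n, x ∈ F n) : ∃ n, H ≤ F n := by
  have : CompactSpace H := isCompact_iff_compactSpace.1 hH
  have hmono : Monotone fun k => (F k).subgroupOf H := fun _ _ hab => comap_mono (hF hab)
  have hcov : ⋃ n, ((F n).subgroupOf H : Set H) = Set.univ :=
    Set.eq_univ_of_forall fun x => Set.mem_iUnion.2 (h x x.2)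
  obtain ⟨n, x, hx⟩ := nonempty_interior_of_iUnion_of_closed
    (fun n => (hFc n).preimage continuous_subtype_val) hcov
  have hopen : ∀ k, IsOpen ((F (n + k)).subgroupOf H : Set H) := fun k =>
    isOpen_mono (hmono (Nat.le_add_right n k))
      (isOpen_of_mem_nhds _ (mem_interior_iff_mem_nhds.1 hx))
  obtain ⟨k, hk⟩ := isCompact_univ.elim_directed_cover _ hopen
    (fun x _ => by
      obtain ⟨m, hm⟩ := h x x.2
      exact Set.mem_iUnion.2 ⟨m, hF (Nat.le_add_left m n) hm⟩)
    (Monotone.directed_le fun a b hab => hmono (Nat.add_le_add_left hab n))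
  exact ⟨n + k, fun x hx => hk (Set.mem_univ ⟨x, hx⟩)⟩

theorem exists_subgroup_toSubmonoid_eq [T2Space G] {M : Submonoid G}
    (hM : IsCompact (M : Set G)) : ∃ T : Subgroup G, T.toSubmonoid = M := by
  refine ⟨{ M with inv_mem' := fun {x} hx => ?_ }, rfl⟩
  -- An idempotent of the compact semigroup `xM` can only be `1`.
  obtain ⟨_, ⟨m, hm, rfl⟩, hidem⟩ := exists_idempotent_in_compact_subsemigroup
    (fun r : G => continuous_mul_const r) ((x * ·) '' (M : Set G))
    ⟨x * 1, 1, M.one_mem, rfl⟩ (hM.image (continuous_const_mul x)) (by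
      rintro _ ⟨a, ha, rfl⟩ _ ⟨b, hb, rfl⟩
      exact ⟨a * (x * b), M.mul_mem ha (M.mul_mem hx hb), by simp only [mul_assoc]⟩)
  have hxm : x * m = 1 := mul_eq_left.1 hidem
  rwa [inv_eq_of_mul_eq_one_right hxm]

theorem isClosed_setOf_forall_mul_mem (L : Set G) {W : Set G} (hW : IsClosed W) :
    IsClosed {x : G | ∀ l ∈ L, l * x ∈ W} := by
  simp only [Set.ofPred_forall]
  exact isClosed_biInter fun l _ => hW.preimage (continuous_const_mul l)

theorem isOpen_setOf_forall_mul_mem {L W : Set G} (hL : IsCompact L) (hW : IsOpen W) :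
    IsOpen {x : G | ∀ l ∈ L, l * x ∈ W} :=
  isOpen_iff_mem_nhds.2 fun _ hx => hL.eventually_forall_of_forall_eventually fun l hl =>
    (hW.preimage (f := fun p : G × G => p.2 * p.1) (by fun_prop)).mem_nhds (hx l hl)

theorem exists_isCompact_isOpen_subgroup (G : Type*) [Group G] [TopologicalSpace G]
    [IsTopologicalGroup G] [LocallyCompactSpace G] [TotallyDisconnectedSpace G] :
    ∃ U : Subgroup G, IsCompact (U : Set G) ∧ IsOpen (U : Set G) := by
  obtain ⟨K, hK, h1K⟩ := exists_compact_mem_nhds (1 : G)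
  obtain ⟨W, hW, h1W, hWK⟩ := (loc_compact_Haus_tot_disc_of_zero_dim (H := G)).mem_nhds_iff.1 h1K
  have hWc : IsCompact W := hK.of_isClosed_subset hW.1 hWK
  let M : Submonoid G :=
    { carrier := {x | ∀ w ∈ W, w * x ∈ W}
      one_mem' := fun w hw => by rwa [mul_one]
      mul_mem' := fun {a b} ha hb w hw => by
        rw [← mul_assoc]
        exact hb _ (ha w hw) }
  have hMW : (M : Set G) ⊆ W := fun x hx => one_mul x ▸ hx 1 h1W
  have hMc : IsCompact (M : Set G) :=
    hWc.of_isClosed_subset (isClosed_setOf_forall_mul_mem W hW.1) hMW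
  have hMo : IsOpen (M : Set G) := isOpen_setOf_forall_mul_mem hWc hW.2
  obtain ⟨U, hU⟩ := exists_subgroup_toSubmonoid_eq hMc
  rw [← hU] at hMc hMo
  exact ⟨U, hMc, hMo⟩

end Topology

section Iterate

variable {G : Type*} [Group G] {α : G →* G} {H K : Subgroup G}

/-- The iterate `αⁿ` as a homomorphism. The power of `α` in `Monoid.End G` is not used because
`plus`, `minus` and `displacementIndex` take arguments of type `G →* G`. -/
def iterHom (α : G →* G) (n : ℕ) : G →* G where
  toFun := α^[n]
  map_one' := iterate_map_one α n
  map_mul' := iterate_map_mul α n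

@[simp]
theorem iterHom_apply (α : G →* G) (n : ℕ) (x : G) : iterHom α n x = α^[n] x := rfl

theorem iterHom_iterHom (α : G →* G) (m n : ℕ) : iterHom (iterHom α m) n = iterHom α (m * n) :=
  MonoidHom.ext fun x => (congrFun (Function.iterate_mul α m n) x).symm

theorem continuous_iterHom [TopologicalSpace G] (hα : Continuous α) (n : ℕ) :
    Continuous (iterHom α n) :=
  hα.iterate n

theorem iterMap_zero (α : G →* G) (H : Subgroup G) : iterMap α 0 H = H := rfl

theorem iterMap_succ (α : G →* G) (n : ℕ) (H : Subgroup G) :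
    iterMap α (n + 1) H = (iterMap α n H).map α :=
  Function.iterate_succ_apply' _ _ _

theorem iterMap_eq_map (α : G →* G) (n : ℕ) (H : Subgroup G) :
    iterMap α n H = H.map (iterHom α n) := by
  induction n with
  | zero => exact (map_id H).symm
  | succ n ih =>
    rw [iterMap_succ, ih, map_map]
    congr 1
    exact MonoidHom.ext fun x => (Function.iterate_succ_apply' α n x).symm

theorem mem_iterMap {n : ℕ} {x : G} : x ∈ iterMap α n H ↔ ∃ h ∈ H, α^[n] h = x := by
  rw [iterMap_eq_map]
  rfl

theorem iterMap_mono (α : G →* G) (n : ℕ) (h : H ≤ K) : iterMap α n H ≤ iterMap α n K := by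
  simp only [iterMap_eq_map]
  exact map_mono h

theorem iterMap_monotone (h : H ≤ H.map α) : Monotone fun n => iterMap α n H :=
  monotone_nat_of_le_succ fun n => iterMap_mono α n h

theorem isCompact_iterMap [TopologicalSpace G] (hα : Continuous α) (n : ℕ)
    (hH : IsCompact (H : Set G)) : IsCompact (iterMap α n H : Set G) := by
  rw [iterMap_eq_map]
  exact hH.image (continuous_iterHom hα n)

theorem relIndex_iterMap_ne_zero (h : H.relIndex (H.map α) ≠ 0) (n : ℕ) :
    H.relIndex (iterMap α n H) ≠ 0 := by
  induction n with
  | zero => simp [iterMap_zero]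
  | succ n ih =>
    rw [iterMap_succ]
    exact relIndex_ne_zero_trans h (relIndex_map_map_ne_zero α ih)

theorem relIndex_iterMap_le_pow (h : H.relIndex (H.map α) ≠ 0) (n : ℕ) :
    H.relIndex (iterMap α n H) ≤ H.relIndex (H.map α) ^ n := by
  induction n with
  | zero => simp [iterMap_zero]
  | succ n ih =>
    have hn := relIndex_iterMap_ne_zero h n
    calc H.relIndex (iterMap α (n + 1) H) = H.relIndex ((iterMap α n H).map α) := by
          rw [iterMap_succ]
      _ ≤ H.relIndex (H.map α) * (H.map α).relIndex ((iterMap α n H).map α) :=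
          relIndex_le_relIndex_mul_relIndex h (relIndex_map_map_ne_zero α hn)
      _ ≤ H.relIndex (H.map α) * H.relIndex (H.map α) ^ n :=
          Nat.mul_le_mul_left _ ((relIndex_map_map_le α hn).trans ih)
      _ = H.relIndex (H.map α) ^ (n + 1) := (pow_succ' _ n).symm

theorem relIndex_mul_relIndex_iterMap_succ (hH : H ≤ H.map α) (n : ℕ) :
    H.relIndex (iterMap α n H) * (iterMap α n H).relIndex (iterMap α (n + 1) H) =
      H.relIndex (iterMap α (n + 1) H) :=
  relIndex_mul_relIndex _ _ _ (iterMap_monotone hH n.zero_le) (iterMap_monotone hH n.le_succ)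

theorem relIndex_iterMap_eq_pow (hH : H ≤ H.map α) {c : ℕ}
    (h : ∀ n, (iterMap α n H).relIndex (iterMap α (n + 1) H) = c) (n : ℕ) :
    H.relIndex (iterMap α n H) = c ^ n := by
  induction n with
  | zero => simp [iterMap_zero]
  | succ n ih => rw [← relIndex_mul_relIndex_iterMap_succ hH, ih, h, pow_succ]

theorem relIndex_iterMap_succ_eq (hH : H ≤ H.map α) {c : ℕ} (hc : c ≠ 0)
    (h : ∀ n, H.relIndex (iterMap α n H) = c ^ n) (n : ℕ) :
    (iterMap α n H).relIndex (iterMap α (n + 1) H) = c := by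
  have hmul := relIndex_mul_relIndex_iterMap_succ hH n
  rw [h, h, pow_succ] at hmul
  exact Nat.eq_of_mul_eq_mul_left (Nat.pos_of_ne_zero (pow_ne_zero n hc)) hmul

theorem relIndex_iterMap_succ_of_ker_inf_le (hH : H ≤ H.map α)
    (hker : ∀ n, α.ker ⊓ iterMap α n H ≤ H) (n : ℕ) :
    (iterMap α n H).relIndex (iterMap α (n + 1) H) = H.relIndex (H.map α) := by
  induction n with
  | zero => rfl
  | succ n ih =>
    have hmono := iterMap_monotone hH
    rw [iterMap_succ α n, iterMap_succ α (n + 1), ← ih]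
    exact relIndex_map_map_of_ker_inf_le (hmono n.le_succ)
      ((hker (n + 1)).trans (hmono n.zero_le))

theorem comap_inf_iterMap_succ_le {c : ℕ} (hc : c ≠ 0)
    (h : ∀ n, (iterMap α n H).relIndex (iterMap α (n + 1) H) = c) (n : ℕ) :
    (iterMap α (n + 1) H).comap α ⊓ iterMap α (n + 1) H ≤ iterMap α n H := by
  refine inf_le_of_relIndex_le ?_ ((h n).trans_ne hc) ?_
  · rw [← map_le_iff_le_comap, iterMap_succ]
  · rw [relIndex_comap, ← iterMap_succ, h, h]

end Iterate

section DisplacementIndex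

variable {G : Type*} [Group G] {α : G →* G} {U V : Subgroup G}

theorem displacementIndex_eq_relIndex_map (α : G →* G) (U : Subgroup G) :
    displacementIndex α U = U.relIndex (U.map α) :=
  inf_relIndex_left _ _

theorem displacementIndex_eq_relIndex_comap (α : G →* G) (U : Subgroup G) :
    displacementIndex α U = (U.comap α).relIndex U := by
  rw [displacementIndex_eq_relIndex_map, relIndex_comap]

theorem displacementIndex_iterHom (α : G →* G) (n : ℕ) (U : Subgroup G) :
    displacementIndex (iterHom α n) U = U.relIndex (iterMap α n U) := by
  rw [displacementIndex_eq_relIndex_map, iterMap_eq_map]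

theorem displacementIndex_iterHom_le_pow (h : displacementIndex α U ≠ 0) (n : ℕ) :
    displacementIndex (iterHom α n) U ≤ displacementIndex α U ^ n := by
  rw [displacementIndex_eq_relIndex_map] at h
  rw [displacementIndex_iterHom, displacementIndex_eq_relIndex_map]
  exact relIndex_iterMap_le_pow h n

theorem displacementIndex_le_mul (hUV : U.relIndex V ≠ 0) (hVU : V.relIndex U ≠ 0)
    (hV : displacementIndex α V ≠ 0) :
    displacementIndex α U ≤ U.relIndex V * V.relIndex U * displacementIndex α V := by
  rw [displacementIndex_eq_relIndex_map] at hV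
  have hmap := relIndex_map_map_ne_zero α hVU
  calc displacementIndex α U = U.relIndex (U.map α) := displacementIndex_eq_relIndex_map α U
    _ ≤ U.relIndex V * (V.relIndex (V.map α) * (V.map α).relIndex (U.map α)) :=
        (relIndex_le_relIndex_mul_relIndex hUV (relIndex_ne_zero_trans hV hmap)).trans
          (Nat.mul_le_mul_left _ (relIndex_le_relIndex_mul_relIndex hV hmap))
    _ ≤ U.relIndex V * (V.relIndex (V.map α) * V.relIndex U) := by
        gcongr
        exact relIndex_map_map_le α hVU
    _ = U.relIndex V * V.relIndex U * displacementIndex α V := by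
        rw [displacementIndex_eq_relIndex_map]
        ring

/-- The displacement index of `U` is multiplicative along the iterates of `α`. For compact open `U`
this is the growth condition to which being minimizing and being tidy are both compared. -/
def HasMultiplicativeDisplacement (α : G →* G) (U : Subgroup G) : Prop :=
  ∀ n, displacementIndex (iterHom α n) U = displacementIndex α U ^ n

theorem HasMultiplicativeDisplacement.iterHom (h : HasMultiplicativeDisplacement α U) (m : ℕ) :
    HasMultiplicativeDisplacement (iterHom α m) U := fun n => by
  rw [iterHom_iterHom, h, h, pow_mul]

variable [TopologicalSpace G] [IsTopologicalGroup G]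

theorem displacementIndex_ne_zero (hα : Continuous α) (hUc : IsCompact (U : Set G))
    (hUo : IsOpen (U : Set G)) : displacementIndex α U ≠ 0 := by
  rw [displacementIndex_eq_relIndex_map]
  exact relIndex_ne_zero_of_isOpen_of_isCompact hUo (hUc.image hα)

theorem HasMultiplicativeDisplacement.isMinimizing (hα : Continuous α)
    (hUc : IsCompact (U : Set G)) (hUo : IsOpen (U : Set G))
    (h : HasMultiplicativeDisplacement α U) : IsMinimizing α U := by
  intro V hVc hVo
  refine le_of_forall_pow_le_mul_pow (C := U.relIndex V * V.relIndex U) fun n => ?_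
  calc displacementIndex α U ^ n = displacementIndex (TidyEnd.iterHom α n) U := (h n).symm
    _ ≤ U.relIndex V * V.relIndex U * displacementIndex (TidyEnd.iterHom α n) V :=
        displacementIndex_le_mul (relIndex_ne_zero_of_isOpen_of_isCompact hUo hVc)
          (relIndex_ne_zero_of_isOpen_of_isCompact hVo hUc)
          (displacementIndex_ne_zero (continuous_iterHom hα n) hVc hVo)
    _ ≤ U.relIndex V * V.relIndex U * displacementIndex α V ^ n :=
        Nat.mul_le_mul_left _
          (displacementIndex_iterHom_le_pow (displacementIndex_ne_zero hα hVc hVo) n)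

theorem IsMinimizing.hasMultiplicativeDisplacement (hα : Continuous α)
    (hUc : IsCompact (U : Set G)) (hUo : IsOpen (U : Set G))
    (hU : HasMultiplicativeDisplacement α U) (hVc : IsCompact (V : Set G))
    (hVo : IsOpen (V : Set G)) (hV : IsMinimizing α V) : HasMultiplicativeDisplacement α V := by
  refine fun n => le_antisymm
    (displacementIndex_iterHom_le_pow (displacementIndex_ne_zero hα hVc hVo) n) ?_
  calc displacementIndex α V ^ n ≤ displacementIndex α U ^ n :=
        Nat.pow_le_pow_left (hV U hUc hUo) n
    _ = displacementIndex (iterHom α n) U := (hU n).symm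
    _ ≤ displacementIndex (iterHom α n) V :=
        (hU.iterHom n).isMinimizing (continuous_iterHom hα n) hUc hUo V hVc hVo

end DisplacementIndex

section PlusMinus

variable {G : Type*} [Group G] {α : G →* G} {U : Subgroup G}

theorem plus_le (α : G →* G) (U : Subgroup G) : plus α U ≤ U := fun _ hx => hx.1

theorem minus_le (α : G →* G) (U : Subgroup G) : minus α U ≤ U := fun _ hx => hx.1

theorem plus_le_map (α : G →* G) (U : Subgroup G) : plus α U ≤ (plus α U).map α := by
  rintro x ⟨_, s, hs, hs0, hs1⟩
  exact ⟨s 1, ⟨hs 1, fun n => s (n + 1), fun n => hs _, rfl, fun n => hs1 _⟩, (hs1 0).trans hs0⟩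

theorem subset_plus {S : Set G} (hSU : S ⊆ U) (hS : S ⊆ α '' S) : S ⊆ plus α U := by
  intro x hx
  choose! f hfS hf using hS
  have hit : ∀ n, f^[n] x ∈ S := fun n => Set.MapsTo.iterate hfS n hx
  refine ⟨hSU hx, fun n => f^[n] x, fun n => hSU (hit n), rfl, fun n => ?_⟩
  simp only [Function.iterate_succ_apply']
  exact hf (hit n)

theorem le_minus {H : Subgroup G} (hHU : H ≤ U) (hH : H.map α ≤ H) : H ≤ minus α U := by
  intro x hx
  have hit : Set.MapsTo α H H := map_le_iff_le_comap.1 hH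
  exact ⟨hHU hx, fun n => hHU (hit.iterate n hx)⟩

theorem map_plus_inf (α : G →* G) (U : Subgroup G) : (plus α U).map α ⊓ U = plus α U := by
  refine le_antisymm (subset_plus (fun x hx => hx.2) ?_) (le_inf (plus_le_map α U) (plus_le α U))
  rintro x ⟨⟨y, hy, rfl⟩, _⟩
  exact ⟨y, ⟨plus_le_map α U hy, plus_le α U hy⟩, rfl⟩

theorem map_mem_minus {x : G} (hx : x ∈ minus α U) : α x ∈ minus α U :=
  ⟨hx.2 1, fun n => hx.2 (n + 1)⟩

theorem relIndex_map_plus (α : G →* G) (U : Subgroup G) :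
    (plus α U).relIndex ((plus α U).map α) = U.relIndex ((plus α U).map α) := by
  rw [← inf_relIndex_left ((plus α U).map α) U, map_plus_inf]

theorem relIndex_map_plus_ne_zero (h : displacementIndex α U ≠ 0) :
    (plus α U).relIndex ((plus α U).map α) ≠ 0 := by
  rw [displacementIndex_eq_relIndex_map] at h
  rw [relIndex_map_plus]
  exact mt (relIndex_eq_zero_of_le_right (map_mono (plus_le α U))) h

theorem displacementIndex_iterHom_of_subset_mul_minus {P : Subgroup G} (hPU : P ≤ U)
    (hU : (U : Set G) ⊆ P * minus α U) (n : ℕ) :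
    displacementIndex (iterHom α n) U = U.relIndex (iterMap α n P) := by
  rw [displacementIndex_iterHom]
  refine (relIndex_eq_of_subset_mul (iterMap_mono α n hPU) fun x hx => ?_).symm
  obtain ⟨u, hu, rfl⟩ := mem_iterMap.1 hx
  obtain ⟨p, hp, m, hm, rfl⟩ := Set.mem_mul.1 (hU hu)
  exact ⟨α^[n] p, mem_iterMap.2 ⟨p, hp, rfl⟩, α^[n] m, hm.2 n, (iterate_map_mul α n p m).symm⟩

theorem hasMultiplicativeDisplacement_of_subset_mul_minus {P : Subgroup G}
    (hP : ∀ n, iterMap α n P ⊓ U = P) (hU : (U : Set G) ⊆ P * minus α U)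
    (hindex : ∀ n, (iterMap α n P).relIndex (iterMap α (n + 1) P) = P.relIndex (P.map α)) :
    HasMultiplicativeDisplacement α U := by
  have hPU : P ≤ U := inf_eq_left.1 (hP 0)
  have hPmap : P ≤ P.map α := (hP 1).symm.le.trans inf_le_left
  have hdisp : ∀ n, displacementIndex (iterHom α n) U = P.relIndex (iterMap α n P) := fun n => by
    rw [displacementIndex_iterHom_of_subset_mul_minus hPU hU, ← inf_relIndex_left, hP]
  intro n
  have hdisp1 : displacementIndex α U = P.relIndex (P.map α) := hdisp 1
  rw [hdisp, hdisp1, relIndex_iterMap_eq_pow hPmap hindex]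

end PlusMinus

section TidyAbove

variable {G : Type*} [Group G] {α : G →* G} {U : Subgroup G}

/-- The subgroup `U ∩ α⁻¹(U) ∩ ⋯ ∩ α⁻ⁿ(U)`. These subgroups decrease to `U₋` and their images
under `αⁿ` decrease to `U₊`. -/
def stay (α : G →* G) (U : Subgroup G) : ℕ → Subgroup G
  | 0 => U
  | n + 1 => U ⊓ (stay α U n).comap α

theorem mem_stay {n : ℕ} {x : G} : x ∈ stay α U n ↔ ∀ k ≤ n, α^[k] x ∈ U := by
  induction n generalizing x with
  | zero => simp [stay]
  | succ n ih =>
    rw [stay, mem_inf, mem_comap, ih]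
    constructor
    · rintro ⟨h0, h⟩ (_ | k) hk
      · exact h0
      · exact h k (Nat.le_of_succ_le_succ hk)
    · exact fun h => ⟨h 0 (Nat.zero_le _), fun k hk => h (k + 1) (Nat.succ_le_succ hk)⟩

theorem stay_antitone (α : G →* G) (U : Subgroup G) : Antitone (stay α U) :=
  fun _ _ hmn _ hx => mem_stay.2 fun k hk => mem_stay.1 hx k (hk.trans hmn)

theorem coe_minus_eq_iInter (α : G →* G) (U : Subgroup G) :
    (minus α U : Set G) = ⋂ n, (stay α U n : Set G) := by
  ext x
  simp only [Set.mem_iInter, SetLike.mem_coe, mem_stay]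
  exact ⟨fun hx _ k _ => hx.2 k, fun h => ⟨h 0 0 le_rfl, fun n => h n n le_rfl⟩⟩

theorem iterMap_stay_antitone (α : G →* G) (U : Subgroup G) :
    Antitone fun n => iterMap α n (stay α U n) :=
  antitone_nat_of_succ_le fun n => iterMap_mono α n (map_le_iff_le_comap.2 inf_le_right)

theorem iterMap_stay_le (α : G →* G) (U : Subgroup G) (n : ℕ) : iterMap α n (stay α U n) ≤ U :=
  iterMap_stay_antitone α U n.zero_le

theorem displacementIndex_stay (α : G →* G) (U : Subgroup G) (n : ℕ) :
    displacementIndex α (stay α U n) = (U.comap α).relIndex (iterMap α n (stay α U n)) := by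
  have h : (stay α U n).comap α ⊓ stay α U n =
      ((U.comap α).comap (iterHom α n)) ⊓ stay α U n := by
    ext x
    simp only [mem_inf, mem_comap, mem_stay, iterHom_apply, ← Function.iterate_succ_apply,
      ← Function.iterate_succ_apply' α]
    refine and_congr_left fun hx => ⟨fun h => h n le_rfl, fun h k hk => ?_⟩
    rcases hk.eq_or_lt with rfl | hk
    · exact h
    · exact hx (k + 1) hk
  rw [displacementIndex_eq_relIndex_comap, ← inf_relIndex_right, h, inf_relIndex_right,
    relIndex_comap, iterMap_eq_map]

theorem IsRegressive.iterate_apply {x : G} {s : ℕ → G} (h : IsRegressive α x s) (n k : ℕ) :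
    α^[k] (s (n + k)) = s n := by
  induction k with
  | zero => rfl
  | succ k ih => rw [Function.iterate_succ_apply, ← add_assoc, h.2, ih]

theorem subset_plus_mul_stay (h : (U : Set G) ⊆ plus α U * stay α U 1) (n : ℕ) :
    (U : Set G) ⊆ plus α U * stay α U n := by
  induction n with
  | zero => exact fun u hu => ⟨1, one_mem _, u, hu, one_mul u⟩
  | succ n ih =>
    intro u hu
    obtain ⟨p, hp, v, ⟨hvU, hv⟩, rfl⟩ := Set.mem_mul.1 (h hu)
    obtain ⟨p', hp', w, hw, hpw⟩ := Set.mem_mul.1 (ih hv)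
    obtain ⟨q, hq, rfl⟩ := plus_le_map α U hp'
    refine ⟨p * q, mul_mem hp hq, q⁻¹ * v, ⟨?_, ?_⟩, by group⟩
    · exact U.mul_mem (U.inv_mem (plus_le α U hq)) hvU
    · change α (q⁻¹ * v) ∈ stay α U n
      rwa [map_mul, ← hpw, map_inv, inv_mul_cancel_left]

variable [TopologicalSpace G]

theorem isOpen_stay (hα : Continuous α) (hUo : IsOpen (U : Set G)) (n : ℕ) :
    IsOpen (stay α U n : Set G) := by
  induction n with
  | zero => exact hUo
  | succ n ih => exact hUo.inter (ih.preimage hα)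

variable [IsTopologicalGroup G]

theorem isCompact_stay (hα : Continuous α) (hUc : IsCompact (U : Set G))
    (hUo : IsOpen (U : Set G)) (n : ℕ) : IsCompact (stay α U n : Set G) :=
  hUc.of_isClosed_subset (isClosed_of_isOpen _ (isOpen_stay hα hUo n))
    (stay_antitone α U n.zero_le)

theorem isCompact_minus (hα : Continuous α) (hUc : IsCompact (U : Set G))
    (hUo : IsOpen (U : Set G)) : IsCompact (minus α U : Set G) := by
  refine hUc.of_isClosed_subset ?_ (minus_le α U)
  rw [coe_minus_eq_iInter]
  exact isClosed_iInter fun n => isClosed_of_isOpen _ (isOpen_stay hα hUo n)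

variable [T2Space G]

theorem coe_plus_eq_iInter (hα : Continuous α) (hUc : IsCompact (U : Set G))
    (hUo : IsOpen (U : Set G)) :
    (plus α U : Set G) = ⋂ n, (iterMap α n (stay α U n) : Set G) := by
  refine Set.Subset.antisymm ?_
    (subset_plus (fun x hx => Set.mem_iInter.1 hx 0) fun x hx => ?_)
  · rintro x ⟨_, s, hs, hsx⟩
    refine Set.mem_iInter.2 fun n => mem_iterMap.2 ⟨s n, mem_stay.2 fun k hkn => ?_, ?_⟩
    · obtain ⟨m, rfl⟩ := Nat.exists_eq_add_of_le' hkn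
      rw [hsx.iterate_apply]
      exact hs m
    · simpa only [zero_add, hsx.1] using hsx.iterate_apply 0 n
  · rw [image_iInter_of_antitone hα (fun _ _ hmn => iterMap_stay_antitone α U hmn)
      fun n => isCompact_iterMap hα n (isCompact_stay hα hUc hUo n)]
    refine Set.mem_iInter.2 fun n => ?_
    have hxn : x ∈ iterMap α (n + 1) (stay α U (n + 1)) := Set.mem_iInter.1 hx (n + 1)
    rw [iterMap_succ] at hxn
    exact map_mono (iterMap_mono α n (stay_antitone α U n.le_succ)) hxn

theorem isCompact_plus (hα : Continuous α) (hUc : IsCompact (U : Set G))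
    (hUo : IsOpen (U : Set G)) : IsCompact (plus α U : Set G) := by
  refine hUc.of_isClosed_subset ?_ (plus_le α U)
  rw [coe_plus_eq_iInter hα hUc hUo]
  exact isClosed_iInter fun n =>
    (isCompact_iterMap hα n (isCompact_stay hα hUc hUo n)).isClosed

theorem IsMinimizing.subset_plus_mul_stay_one (hα : Continuous α) (hUc : IsCompact (U : Set G))
    (hUo : IsOpen (U : Set G)) (hU : IsMinimizing α U) :
    (U : Set G) ⊆ plus α U * stay α U 1 := by
  have hmul : ∀ n, (U : Set G) ⊆ iterMap α n (stay α U n) * stay α U 1 := fun n u hu => by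
    have hle := hU _ (isCompact_stay hα hUc hUo n) (isOpen_stay hα hUo n)
    have h0 := displacementIndex_ne_zero hα hUc hUo
    rw [displacementIndex_eq_relIndex_comap] at h0
    rw [displacementIndex_stay, displacementIndex_eq_relIndex_comap] at hle
    obtain ⟨w, hw, v, hv, rfl⟩ := subset_mul_of_relIndex_le (iterMap_stay_le α U n) h0 hle hu
    exact ⟨w, hw, v, ⟨(mul_mem_cancel_left (iterMap_stay_le α U n hw)).1 hu, hv⟩, rfl⟩
  have hinter := iInter_mul_iInter_of_antitone (fun _ _ hmn => iterMap_stay_antitone α U hmn)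
    (antitone_const (c := (stay α U 1 : Set G)))
    (fun n => isCompact_iterMap hα n (isCompact_stay hα hUc hUo n))
    fun _ => isCompact_stay hα hUc hUo 1
  rw [Set.iInter_const, ← coe_plus_eq_iInter hα hUc hUo] at hinter
  exact hinter ▸ Set.subset_iInter hmul

theorem IsMinimizing.isTidyAbove (hα : Continuous α) (hUc : IsCompact (U : Set G))
    (hUo : IsOpen (U : Set G)) (hU : IsMinimizing α U) : IsTidyAbove α U := by
  refine Set.Subset.antisymm ?_ (coe_mul_coe U ▸ Set.mul_subset_mul (plus_le α U) (minus_le α U))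
  have hinter := iInter_mul_iInter_of_antitone (antitone_const (c := (plus α U : Set G)))
    (fun _ _ hmn => stay_antitone α U hmn) (fun _ => isCompact_plus hα hUc hUo)
    (isCompact_stay hα hUc hUo)
  rw [Set.iInter_const, ← coe_minus_eq_iInter] at hinter
  exact hinter ▸ Set.subset_iInter
    (subset_plus_mul_stay (hU.subset_plus_mul_stay_one hα hUc hUo))

end TidyAbove

section PlusPlus

variable {G : Type*} [Group G] {α : G →* G} {U : Subgroup G}

theorem iterMap_plus_monotone (α : G →* G) (U : Subgroup G) :
    Monotone fun n => iterMap α n (plus α U) :=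
  iterMap_monotone (plus_le_map α U)

/-- `U₊₊` as a subgroup of `G`. -/
def plusPlusSubgroup (α : G →* G) (U : Subgroup G) : Subgroup G where
  carrier := plusPlus α U
  one_mem' := Set.mem_iUnion.2 ⟨0, one_mem _⟩
  mul_mem' := by
    intro x y hx hy
    obtain ⟨m, hm⟩ := Set.mem_iUnion.1 hx
    obtain ⟨n, hn⟩ := Set.mem_iUnion.1 hy
    exact Set.mem_iUnion.2 ⟨max m n, mul_mem (iterMap_plus_monotone α U (le_max_left m n) hm)
      (iterMap_plus_monotone α U (le_max_right m n) hn)⟩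
  inv_mem' := by
    intro x hx
    obtain ⟨m, hm⟩ := Set.mem_iUnion.1 hx
    exact Set.mem_iUnion.2 ⟨m, inv_mem hm⟩

theorem mem_plusPlusSubgroup {x : G} :
    x ∈ plusPlusSubgroup α U ↔ ∃ n, x ∈ iterMap α n (plus α U) :=
  Set.mem_iUnion

theorem iterMap_plus_le_plusPlusSubgroup (α : G →* G) (U : Subgroup G) (n : ℕ) :
    iterMap α n (plus α U) ≤ plusPlusSubgroup α U :=
  fun _ hx => mem_plusPlusSubgroup.2 ⟨n, hx⟩

theorem plus_le_plusPlusSubgroup (α : G →* G) (U : Subgroup G) :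
    plus α U ≤ plusPlusSubgroup α U :=
  iterMap_plus_le_plusPlusSubgroup α U 0

theorem map_plusPlusSubgroup (α : G →* G) (U : Subgroup G) :
    (plusPlusSubgroup α U).map α = plusPlusSubgroup α U := by
  refine le_antisymm ?_ fun x hx => ?_
  · rintro _ ⟨x, hx, rfl⟩
    obtain ⟨n, hn⟩ := mem_plusPlusSubgroup.1 hx
    refine mem_plusPlusSubgroup.2 ⟨n + 1, ?_⟩
    rw [iterMap_succ]
    exact mem_map_of_mem α hn
  · obtain ⟨n, hn⟩ := mem_plusPlusSubgroup.1 hx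
    have hsucc : x ∈ iterMap α (n + 1) (plus α U) := iterMap_plus_monotone α U n.le_succ hn
    rw [iterMap_succ] at hsucc
    exact map_mono (iterMap_plus_le_plusPlusSubgroup α U n) hsucc

theorem iterMap_plusPlusSubgroup (α : G →* G) (U : Subgroup G) (n : ℕ) :
    iterMap α n (plusPlusSubgroup α U) = plusPlusSubgroup α U :=
  Function.iterate_fixed (map_plusPlusSubgroup α U) n

theorem map_mem_plusPlusSubgroup {x : G} (hx : x ∈ plusPlusSubgroup α U) :
    α x ∈ plusPlusSubgroup α U :=
  map_plusPlusSubgroup α U ▸ mem_map_of_mem α hx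

end PlusPlus

section Tidy

variable {G : Type*} [Group G] {α : G →* G} {U : Subgroup G}

theorem IsTidyAbove.subset_plus_mul_minus (h : IsTidyAbove α U) :
    (U : Set G) ⊆ plus α U * minus α U :=
  Eq.subset h

theorem IsTidyAbove.displacementIndex_eq (h : IsTidyAbove α U) :
    displacementIndex α U = (plus α U).relIndex ((plus α U).map α) := by
  rw [relIndex_map_plus]
  exact displacementIndex_iterHom_of_subset_mul_minus (plus_le α U) h.subset_plus_mul_minus 1

theorem IsTidyAbove.relIndex_iterMap_plus (h : IsTidyAbove α U)
    (hm : HasMultiplicativeDisplacement α U) (h0 : displacementIndex α U ≠ 0) (n : ℕ) :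
    (plus α U).relIndex (iterMap α n (plus α U)) = displacementIndex α U ^ n := by
  have hne := relIndex_map_plus_ne_zero h0
  refine le_antisymm (h.displacementIndex_eq ▸ relIndex_iterMap_le_pow hne n) ?_
  rw [← hm, displacementIndex_iterHom_of_subset_mul_minus (plus_le α U) h.subset_plus_mul_minus]
  exact relIndex_le_of_le_left (plus_le α U) (relIndex_iterMap_ne_zero hne n)

theorem IsTidyAbove.plusPlusSubgroup_inf (h : IsTidyAbove α U)
    (hm : HasMultiplicativeDisplacement α U) (h0 : displacementIndex α U ≠ 0) :
    plusPlusSubgroup α U ⊓ U = plus α U := by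
  refine le_antisymm (fun x hx => ?_) (le_inf (plus_le_plusPlusSubgroup α U) (plus_le α U))
  obtain ⟨n, hn⟩ := mem_plusPlusSubgroup.1 hx.1
  have hpow := h.relIndex_iterMap_plus hm h0 n
  refine inf_le_of_relIndex_le (plus_le α U) (hpow.trans_ne (pow_ne_zero n h0)) ?_ ⟨hx.2, hn⟩
  rw [hpow, ← hm,
    displacementIndex_iterHom_of_subset_mul_minus (plus_le α U) h.subset_plus_mul_minus]

variable [TopologicalSpace G] [IsTopologicalGroup G] [T2Space G]

theorem HasMultiplicativeDisplacement.isTidyBelow (hα : Continuous α)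
    (hUc : IsCompact (U : Set G)) (hUo : IsOpen (U : Set G))
    (hm : HasMultiplicativeDisplacement α U) (h : IsTidyAbove α U) : IsTidyBelow α U := by
  have h0 := displacementIndex_ne_zero hα hUc hUo
  refine ⟨isClosed_of_isClosed_inf (H := plusPlusSubgroup α U) hUo ?_, displacementIndex α U,
    relIndex_iterMap_succ_eq (plus_le_map α U) h0 (h.relIndex_iterMap_plus hm h0)⟩
  rw [h.plusPlusSubgroup_inf hm h0]
  exact (isCompact_plus hα hUc hUo).isClosed

theorem IsTidyBelow.plusPlusSubgroup_inf_minus_le (hα : Continuous α)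
    (hUc : IsCompact (U : Set G)) (hUo : IsOpen (U : Set G)) (h : IsTidyBelow α U) :
    plusPlusSubgroup α U ⊓ minus α U ≤ plus α U := by
  obtain ⟨hcl, c, hc⟩ := h
  have hc0 : c ≠ 0 := by
    rw [← hc 0]
    exact relIndex_map_plus_ne_zero (displacementIndex_ne_zero hα hUc hUo)
  obtain ⟨n, hn⟩ := exists_le_of_isCompact_of_forall_exists_mem
    (H := plusPlusSubgroup α U ⊓ minus α U) ((isCompact_minus hα hUc hUo).inter_left hcl)
    (iterMap_plus_monotone α U)
    (fun n => (isCompact_iterMap hα n (isCompact_plus hα hUc hUo)).isClosed)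
    fun x hx => mem_plusPlusSubgroup.1 hx.1
  induction n with
  | zero => exact hn
  | succ n ih =>
    exact ih fun x hx => comap_inf_iterMap_succ_le hc0 hc n
      ⟨hn ⟨map_mem_plusPlusSubgroup hx.1, map_mem_minus hx.2⟩, hn hx⟩

theorem IsTidy.plusPlusSubgroup_inf (hα : Continuous α) (hUc : IsCompact (U : Set G))
    (hUo : IsOpen (U : Set G)) (h : IsTidy α U) : plusPlusSubgroup α U ⊓ U = plus α U := by
  refine le_antisymm (fun x hx => ?_) (le_inf (plus_le_plusPlusSubgroup α U) (plus_le α U))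
  obtain ⟨p, hp, m, hm, rfl⟩ := h.1.subset_plus_mul_minus hx.2
  exact mul_mem hp (h.2.plusPlusSubgroup_inf_minus_le hα hUc hUo
    ⟨(mul_mem_cancel_left (plus_le_plusPlusSubgroup α U hp)).1 hx.1, hm⟩)

theorem IsTidy.hasMultiplicativeDisplacement (hα : Continuous α) (hUc : IsCompact (U : Set G))
    (hUo : IsOpen (U : Set G)) (h : IsTidy α U) : HasMultiplicativeDisplacement α U := by
  obtain ⟨c, hc⟩ := h.2.2
  refine hasMultiplicativeDisplacement_of_subset_mul_minus (fun n => le_antisymm ?_ ?_)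
    h.1.subset_plus_mul_minus fun n => (hc n).trans (hc 0).symm
  · exact (inf_le_inf_right U (iterMap_plus_le_plusPlusSubgroup α U n)).trans
      (h.plusPlusSubgroup_inf hα hUc hUo).le
  · exact le_inf (iterMap_plus_monotone α U n.zero_le) (plus_le α U)

end Tidy

section Homoclinic

variable {G : Type*} [Group G] {α : G →* G} {U : Subgroup G}

/-- The subgroup `U₋₋` of elements whose forward orbit is eventually in `U`, or equivalently
eventually in `U₋`. -/
def minusMinus (α : G →* G) (U : Subgroup G) : Subgroup G where
  carrier := {x | ∀ᶠ n in Filter.atTop, α^[n] x ∈ U}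
  one_mem' := Filter.Eventually.of_forall fun n => by
    rw [iterate_map_one]
    exact U.one_mem
  mul_mem' := fun hx hy => by
    filter_upwards [hx, hy] with n hxn hyn
    rw [iterate_map_mul]
    exact U.mul_mem hxn hyn
  inv_mem' := fun hx => by
    filter_upwards [hx] with n hxn
    rw [iterate_map_inv]
    exact U.inv_mem hxn

theorem mem_minusMinus {x : G} : x ∈ minusMinus α U ↔ ∀ᶠ n in Filter.atTop, α^[n] x ∈ U := Iff.rfl

theorem minus_le_minusMinus (α : G →* G) (U : Subgroup G) : minus α U ≤ minusMinus α U :=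
  fun _ hx => Filter.Eventually.of_forall hx.2

theorem eventually_iterate_mem_minus {x : G} (hx : x ∈ minusMinus α U) :
    ∀ᶠ n in Filter.atTop, α^[n] x ∈ minus α U := by
  filter_upwards [Filter.eventually_forall_ge_atTop.2 hx] with n hn
  refine ⟨hn n le_rfl, fun k => ?_⟩
  rw [← Function.iterate_add_apply]
  exact hn _ (Nat.le_add_left n k)

theorem iterate_mem_minusMinus {k : ℕ} {x : G} :
    α^[k] x ∈ minusMinus α U ↔ x ∈ minusMinus α U := by
  simp only [mem_minusMinus, ← Function.iterate_add_apply]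
  rw [← Filter.eventually_map (m := (· + k)) (P := fun n => α^[n] x ∈ U),
    Filter.map_add_atTop_eq_nat]

theorem map_mem_minusMinus {x : G} : α x ∈ minusMinus α U ↔ x ∈ minusMinus α U :=
  iterate_mem_minusMinus (k := 1)

/-- The subgroup `ℒ = U₊₊ ∩ U₋₋` of elements that have a regressive sequence ending up in `U₊` and
a forward orbit ending up in `U₋`. It is the obstruction to tidiness below. -/
def homoclinic (α : G →* G) (U : Subgroup G) : Subgroup G :=
  plusPlusSubgroup α U ⊓ minusMinus α U

theorem homoclinic_le_plusPlusSubgroup (α : G →* G) (U : Subgroup G) :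
    homoclinic α U ≤ plusPlusSubgroup α U :=
  inf_le_left

theorem homoclinic_le_minusMinus (α : G →* G) (U : Subgroup G) :
    homoclinic α U ≤ minusMinus α U :=
  inf_le_right

theorem map_homoclinic (α : G →* G) (U : Subgroup G) :
    (homoclinic α U).map α = homoclinic α U := by
  refine le_antisymm ?_ fun x hx => ?_
  · rintro _ ⟨x, hx, rfl⟩
    exact ⟨map_mem_plusPlusSubgroup hx.1, map_mem_minusMinus.2 hx.2⟩
  · obtain ⟨y, hy, rfl⟩ := (map_plusPlusSubgroup α U).ge hx.1
    exact ⟨y, ⟨hy, map_mem_minusMinus.1 hx.2⟩, rfl⟩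

theorem map_mem_homoclinic {x : G} (hx : x ∈ homoclinic α U) : α x ∈ homoclinic α U :=
  map_homoclinic α U ▸ mem_map_of_mem α hx

theorem ker_inf_plusPlusSubgroup_le_homoclinic (α : G →* G) (U : Subgroup G) :
    α.ker ⊓ plusPlusSubgroup α U ≤ homoclinic α U := fun _ hx =>
  ⟨hx.2, map_mem_minusMinus.1 ((MonoidHom.mem_ker.1 hx.1).symm ▸ one_mem _)⟩

theorem IsTidyAbove.subset_minus_mul_plus (h : IsTidyAbove α U) :
    (U : Set G) ⊆ minus α U * plus α U := by
  rw [← inv_coe_set (H := U), h, mul_inv_rev, inv_coe_set, inv_coe_set]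

theorem IsTidyAbove.mem_plus_mul_homoclinic (h : IsTidyAbove α U) {x : G}
    (hx : x ∈ plusPlusSubgroup α U) (hxU : x ∈ (U : Set G) * (homoclinic α U : Set G)) :
    x ∈ (plus α U : Set G) * homoclinic α U := by
  obtain ⟨u, hu, l, hl, rfl⟩ := Set.mem_mul.1 hxU
  obtain ⟨p, hp, m, hm, rfl⟩ := Set.mem_mul.1 (h.subset_plus_mul_minus hu)
  have hpm : p * m ∈ plusPlusSubgroup α U :=
    (mul_mem_cancel_right (homoclinic_le_plusPlusSubgroup α U hl)).1 hx
  have hm' : m ∈ plusPlusSubgroup α U :=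
    (mul_mem_cancel_left (plus_le_plusPlusSubgroup α U hp)).1 hpm
  exact ⟨p, hp, m * l, mul_mem ⟨hm', minus_le_minusMinus α U hm⟩ hl, (mul_assoc _ _ _).symm⟩

end Homoclinic

section TidyingMonoid

variable {G : Type*} [Group G] {α : G →* G} {U : Subgroup G}

/-- The submonoid of all `x` with `ℒx ⊆ Uℒ`, where `ℒ` is the homoclinic subgroup. For compact
open `U` it is a compact open subgroup; unlike `U` it always contains `ℒ`. -/
def tidyingMonoid (α : G →* G) (U : Subgroup G) : Submonoid G where
  carrier := {x | ∀ l ∈ homoclinic α U, l * x ∈ (U : Set G) * homoclinic α U}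
  one_mem' := fun l hl => ⟨1, one_mem _, l, hl, (one_mul l).trans (mul_one l).symm⟩
  mul_mem' := by
    intro x y hx hy l hl
    obtain ⟨u, hu, l', hl', h⟩ := Set.mem_mul.1 (hx l hl)
    obtain ⟨u', hu', l'', hl'', h'⟩ := Set.mem_mul.1 (hy l' hl')
    refine Set.mem_mul.2 ⟨u * u', mul_mem hu hu', l'', hl'', ?_⟩
    rw [← mul_assoc, ← h, mul_assoc u l', ← h', mul_assoc]

theorem mem_tidyingMonoid_of_mem_homoclinic {x : G} (hx : x ∈ homoclinic α U) :
    x ∈ tidyingMonoid α U :=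
  fun l hl => ⟨1, one_mem _, l * x, mul_mem hl hx, one_mul _⟩

theorem tidyingMonoid_subset_mul_homoclinic (α : G →* G) (U : Subgroup G) :
    (tidyingMonoid α U : Set G) ⊆ U * homoclinic α U :=
  fun x hx => one_mul x ▸ hx 1 (one_mem _)

theorem IsTidyAbove.mem_tidyingMonoid_of_mul_mem (hU : IsTidyAbove α U) {p m : G}
    (hp : p ∈ plus α U) (hm : m ∈ minus α U) (h : p * m ∈ tidyingMonoid α U) :
    p ∈ tidyingMonoid α U := by
  intro l hl
  obtain ⟨v, hv, l', hl', h'⟩ := Set.mem_mul.1 (h l hl)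
  obtain ⟨q, hq, n, hn, rfl⟩ := Set.mem_mul.1 (hU.subset_plus_mul_minus hv)
  have heq : q⁻¹ * (l * p) = n * l' * m⁻¹ := by
    rw [eq_mul_inv_iff_mul_eq, mul_assoc, mul_assoc, inv_mul_eq_iff_eq_mul, ← h', mul_assoc]
  refine ⟨q, plus_le α U hq, q⁻¹ * (l * p), mem_inf.2 ⟨?_, ?_⟩, mul_inv_cancel_left _ _⟩
  · exact mul_mem (inv_mem (plus_le_plusPlusSubgroup α U hq))
      (mul_mem (homoclinic_le_plusPlusSubgroup α U hl) (plus_le_plusPlusSubgroup α U hp))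
  · rw [heq]
    exact mul_mem (mul_mem (minus_le_minusMinus α U hn) (homoclinic_le_minusMinus α U hl'))
      (inv_mem (minus_le_minusMinus α U hm))

theorem IsTidyAbove.map_mem_tidyingMonoid (hU : IsTidyAbove α U) {m : G} (hm : m ∈ minus α U)
    (h : m ∈ tidyingMonoid α U) : α m ∈ tidyingMonoid α U := by
  intro _ hαl
  obtain ⟨l, hl, rfl⟩ := (map_homoclinic α U).ge hαl
  obtain ⟨v, hv, l', hl', h'⟩ := Set.mem_mul.1 (h l hl)
  obtain ⟨n, hn, q, hq, rfl⟩ := Set.mem_mul.1 (hU.subset_minus_mul_plus hv)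
  rw [mul_assoc] at h'
  have hmem : q * l' ∈ homoclinic α U := by
    refine mem_inf.2 ⟨mul_mem (plus_le_plusPlusSubgroup α U hq)
      (homoclinic_le_plusPlusSubgroup α U hl'), ?_⟩
    rw [eq_inv_mul_of_mul_eq h']
    exact mul_mem (inv_mem (minus_le_minusMinus α U hn))
      (mul_mem (homoclinic_le_minusMinus α U hl) (minus_le_minusMinus α U hm))
  exact ⟨α n, minus_le α U (map_mem_minus hn), α (q * l'), map_mem_homoclinic hmem, by
    simp only [← map_mul, h']⟩

theorem IsTidyAbove.mem_tidyingMonoid_of_map_mem (hU : IsTidyAbove α U) {y : G}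
    (hy : y ∈ plusPlusSubgroup α U) (h : α y ∈ tidyingMonoid α U) : y ∈ tidyingMonoid α U := by
  intro l hl
  have hly : l * y ∈ plusPlusSubgroup α U := mul_mem (homoclinic_le_plusPlusSubgroup α U hl) hy
  obtain ⟨_, hp, _, hl', h'⟩ := Set.mem_mul.1 (hU.mem_plus_mul_homoclinic
    (map_mem_plusPlusSubgroup hly) (map_mul α l y ▸ h _ (map_mem_homoclinic hl)))
  obtain ⟨q, hq, rfl⟩ := plus_le_map α U hp
  obtain ⟨k, hk, rfl⟩ := (map_homoclinic α U).ge hl'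
  have hqk : q * k ∈ plusPlusSubgroup α U :=
    mul_mem (plus_le_plusPlusSubgroup α U hq) (homoclinic_le_plusPlusSubgroup α U hk)
  have hmem : (q * k)⁻¹ * (l * y) ∈ homoclinic α U := by
    refine ker_inf_plusPlusSubgroup_le_homoclinic α U
      (mem_inf.2 ⟨?_, mul_mem (inv_mem hqk) hly⟩)
    rw [MonoidHom.mem_ker, map_mul, map_inv, ← h', map_mul, inv_mul_cancel]
  exact ⟨q, plus_le α U hq, k * ((q * k)⁻¹ * (l * y)), mul_mem hk hmem, by group⟩

variable {T : Subgroup G}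

theorem homoclinic_le_of_toSubmonoid_eq (hT : T.toSubmonoid = tidyingMonoid α U) :
    homoclinic α U ≤ T := fun _ hx =>
  (SetLike.ext_iff.1 hT _).2 (mem_tidyingMonoid_of_mem_homoclinic hx)

theorem IsTidyAbove.le_map_plusPlusSubgroup_inf (hU : IsTidyAbove α U)
    (hT : T.toSubmonoid = tidyingMonoid α U) :
    plusPlusSubgroup α U ⊓ T ≤ (plusPlusSubgroup α U ⊓ T).map α := by
  intro x hx
  obtain ⟨y, hy, rfl⟩ := (map_plusPlusSubgroup α U).ge hx.1
  exact ⟨y, ⟨hy, (SetLike.ext_iff.1 hT y).2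
    (hU.mem_tidyingMonoid_of_map_mem hy ((SetLike.ext_iff.1 hT _).1 hx.2))⟩, rfl⟩

theorem IsTidyAbove.minus_inf_le_minus (hU : IsTidyAbove α U)
    (hT : T.toSubmonoid = tidyingMonoid α U) : minus α U ⊓ T ≤ minus α T := by
  refine le_minus inf_le_right ?_
  rintro _ ⟨x, hx, rfl⟩
  exact ⟨map_mem_minus hx.1, (SetLike.ext_iff.1 hT _).2
    (hU.map_mem_tidyingMonoid hx.1 ((SetLike.ext_iff.1 hT x).1 hx.2))⟩

theorem IsTidyAbove.subset_plusPlusSubgroup_inf_mul_minus (hU : IsTidyAbove α U)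
    (hT : T.toSubmonoid = tidyingMonoid α U) :
    (T : Set G) ⊆ (plusPlusSubgroup α U ⊓ T : Subgroup G) * minus α T := by
  have hLT := homoclinic_le_of_toSubmonoid_eq hT
  intro t ht
  obtain ⟨u, hu, l, hl, rfl⟩ := Set.mem_mul.1
    (tidyingMonoid_subset_mul_homoclinic α U ((SetLike.ext_iff.1 hT t).1 ht))
  obtain ⟨p, hp, m, hm, rfl⟩ := Set.mem_mul.1 (hU.subset_plus_mul_minus hu)
  have hpm : p * m ∈ T := (mul_mem_cancel_right (hLT hl)).1 ht
  have hpT : p ∈ T := (SetLike.ext_iff.1 hT p).2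
    (hU.mem_tidyingMonoid_of_mul_mem hp hm ((SetLike.ext_iff.1 hT _).1 hpm))
  have hmT : m ∈ minus α T := hU.minus_inf_le_minus hT ⟨hm, (mul_mem_cancel_left hpT).1 hpm⟩
  have hlT : l ∈ minus α T := le_minus hLT (map_homoclinic α U).le hl
  exact ⟨p, ⟨plus_le_plusPlusSubgroup α U hp, hpT⟩, m * l, mul_mem hmT hlT,
    (mul_assoc p m l).symm⟩

theorem IsTidyAbove.hasMultiplicativeDisplacement_of_toSubmonoid_eq (hU : IsTidyAbove α U)
    (hT : T.toSubmonoid = tidyingMonoid α U) : HasMultiplicativeDisplacement α T := by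
  have hmap := hU.le_map_plusPlusSubgroup_inf hT
  have hle : ∀ n, iterMap α n (plusPlusSubgroup α U ⊓ T) ≤ plusPlusSubgroup α U := fun n =>
    (iterMap_mono α n inf_le_left).trans (iterMap_plusPlusSubgroup α U n).le
  have hLP : homoclinic α U ≤ plusPlusSubgroup α U ⊓ T :=
    le_inf (homoclinic_le_plusPlusSubgroup α U) (homoclinic_le_of_toSubmonoid_eq hT)
  refine hasMultiplicativeDisplacement_of_subset_mul_minus (fun n => ?_)
    (hU.subset_plusPlusSubgroup_inf_mul_minus hT)
    (relIndex_iterMap_succ_of_ker_inf_le hmap fun n => ?_)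
  · exact le_antisymm (inf_le_inf_right T (hle n))
      (le_inf (iterMap_monotone hmap n.zero_le) inf_le_right)
  · exact (inf_le_inf_left _ (hle n)).trans
      ((ker_inf_plusPlusSubgroup_le_homoclinic α U).trans hLP)

end TidyingMonoid

section Compactness

variable {G : Type*} [Group G] {α : G →* G} {U : Subgroup G}

/-- The subgroup `ℒ₊ = U₊ ∩ U₋₋`, which increases to the homoclinic subgroup under the iterates of
`α`. -/
def homoclinicPlus (α : G →* G) (U : Subgroup G) : Subgroup G :=
  plus α U ⊓ minusMinus α U

theorem homoclinicPlus_le_plus (α : G →* G) (U : Subgroup G) : homoclinicPlus α U ≤ plus α U :=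
  inf_le_left

theorem homoclinicPlus_le_map (α : G →* G) (U : Subgroup G) :
    homoclinicPlus α U ≤ (homoclinicPlus α U).map α := by
  intro x hx
  obtain ⟨y, hy, rfl⟩ := plus_le_map α U hx.1
  exact ⟨y, ⟨hy, map_mem_minusMinus.1 hx.2⟩, rfl⟩

theorem map_homoclinicPlus_inf (α : G →* G) (U : Subgroup G) :
    (homoclinicPlus α U).map α ⊓ U = homoclinicPlus α U := by
  refine le_antisymm ?_
    (le_inf (homoclinicPlus_le_map α U) ((homoclinicPlus_le_plus α U).trans (plus_le α U)))
  rintro _ ⟨⟨x, hx, rfl⟩, hxU⟩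
  exact ⟨(map_plus_inf α U).le ⟨mem_map_of_mem α hx.1, hxU⟩, map_mem_minusMinus.2 hx.2⟩

theorem relIndex_map_homoclinicPlus_ne_zero (h : displacementIndex α U ≠ 0) :
    (homoclinicPlus α U).relIndex ((homoclinicPlus α U).map α) ≠ 0 := by
  rw [displacementIndex_eq_relIndex_map] at h
  have hindex := inf_relIndex_left ((homoclinicPlus α U).map α) U
  rw [map_homoclinicPlus_inf] at hindex
  rw [hindex]
  exact mt (relIndex_eq_zero_of_le_right
    (map_mono ((homoclinicPlus_le_plus α U).trans (plus_le α U)))) h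

theorem exists_mem_iterMap_homoclinicPlus {x : G} (hx : x ∈ homoclinic α U) :
    ∃ n, x ∈ iterMap α n (homoclinicPlus α U) := by
  obtain ⟨n, hn⟩ := mem_plusPlusSubgroup.1 hx.1
  obtain ⟨y, hy, rfl⟩ := mem_iterMap.1 hn
  exact ⟨n, mem_iterMap.2 ⟨y, ⟨hy, iterate_mem_minusMinus.1 hx.2⟩, rfl⟩⟩

theorem eventually_iterMap_homoclinicPlus_succ_subset (h : displacementIndex α U ≠ 0) :
    ∀ᶠ n in Filter.atTop, (iterMap α (n + 1) (homoclinicPlus α U) : Set G) ⊆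
      minus α U * iterMap α n (homoclinicPlus α U) := by
  -- Finitely many cosets cover `α(ℒ₊)`, so one `n` moves all their representatives into `U₋`.
  obtain ⟨F, hF, hFsub, hFcov⟩ :=
    exists_finite_subset_mul_of_relIndex_ne_zero (relIndex_map_homoclinicPlus_ne_zero h)
  have hFminus : ∀ᶠ n in Filter.atTop, ∀ f ∈ F, α^[n] f ∈ minus α U := by
    refine (Filter.eventually_all_finite hF).2 fun f hf => eventually_iterate_mem_minus ?_
    obtain ⟨y, hy, rfl⟩ := hFsub hf
    exact map_mem_minusMinus.2 hy.2
  filter_upwards [hFminus] with n hn x hx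
  obtain ⟨y, hy, rfl⟩ := mem_iterMap.1 hx
  obtain ⟨f, hf, q, hq, hfq⟩ := Set.mem_mul.1 (hFcov (mem_map_of_mem α hy))
  refine Set.mem_mul.2 ⟨α^[n] f, hn f hf, α^[n] q, mem_iterMap.2 ⟨q, hq, rfl⟩, ?_⟩
  rw [← iterate_map_mul, hfq, Function.iterate_succ_apply]

theorem exists_homoclinic_subset_minus_mul (h : displacementIndex α U ≠ 0) :
    ∃ N, (homoclinic α U : Set G) ⊆ minus α U * iterMap α N (homoclinicPlus α U) := by
  obtain ⟨N, hN⟩ := Filter.eventually_atTop.1 (eventually_iterMap_homoclinicPlus_succ_subset h)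
  have hsub : ∀ k, (iterMap α (N + k) (homoclinicPlus α U) : Set G) ⊆
      minus α U * iterMap α N (homoclinicPlus α U) := fun k => by
    induction k with
    | zero => exact fun x hx => ⟨1, one_mem _, x, hx, one_mul x⟩
    | succ k ih =>
      refine (hN (N + k) (Nat.le_add_right N k)).trans ((Set.mul_subset_mul_left ih).trans ?_)
      rw [← mul_assoc, coe_mul_coe]
  refine ⟨N, fun x hx => ?_⟩
  obtain ⟨n, hn⟩ := exists_mem_iterMap_homoclinicPlus hx
  exact hsub n (iterMap_monotone (homoclinicPlus_le_map α U) (Nat.le_add_left n N) hn)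

variable [TopologicalSpace G] [IsTopologicalGroup G] [T2Space G]

theorem isCompact_closure_homoclinic (hα : Continuous α) (hUc : IsCompact (U : Set G))
    (hUo : IsOpen (U : Set G)) : IsCompact (_root_.closure (homoclinic α U : Set G)) := by
  obtain ⟨N, hN⟩ := exists_homoclinic_subset_minus_mul (displacementIndex_ne_zero hα hUc hUo)
  exact ((isCompact_minus hα hUc hUo).mul
    (isCompact_iterMap hα N (isCompact_plus hα hUc hUo))).closure_of_subset
    (hN.trans (Set.mul_subset_mul_left (iterMap_mono α N (homoclinicPlus_le_plus α U))))

theorem isCompact_mul_homoclinic (hα : Continuous α) (hUc : IsCompact (U : Set G))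
    (hUo : IsOpen (U : Set G)) : IsCompact ((U : Set G) * (homoclinic α U : Set G)) := by
  rw [← hUo.mul_closure]
  exact hUc.mul (isCompact_closure_homoclinic hα hUc hUo)

theorem isCompact_tidyingMonoid (hα : Continuous α) (hUc : IsCompact (U : Set G))
    (hUo : IsOpen (U : Set G)) : IsCompact (tidyingMonoid α U : Set G) :=
  have hc := isCompact_mul_homoclinic hα hUc hUo
  hc.of_isClosed_subset (isClosed_setOf_forall_mul_mem _ hc.isClosed)
    (tidyingMonoid_subset_mul_homoclinic α U)

theorem isOpen_tidyingMonoid (hα : Continuous α) (hUc : IsCompact (U : Set G))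
    (hUo : IsOpen (U : Set G)) : IsOpen (tidyingMonoid α U : Set G) := by
  have hcl := (isCompact_mul_homoclinic hα hUc hUo).isClosed
  have hclosure : (tidyingMonoid α U : Set G) = {x | ∀ l ∈ _root_.closure (homoclinic α U : Set G),
      l * x ∈ (U : Set G) * homoclinic α U} :=
    Set.Subset.antisymm
      (fun x hx => closure_minimal (s := (homoclinic α U : Set G)) hx
        (hcl.preimage (continuous_mul_const x)))
      fun x hx l hl => hx l (subset_closure hl)
  rw [hclosure]
  exact isOpen_setOf_forall_mul_mem (isCompact_closure_homoclinic hα hUc hUo) hUo.mul_right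

end Compactness

section Minimizing

variable {G : Type*} [Group G] [TopologicalSpace G] {α : G →* G} {U : Subgroup G}

theorem exists_isMinimizing (α : G →* G)
    (hG : ∃ U : Subgroup G, IsCompact (U : Set G) ∧ IsOpen (U : Set G)) :
    ∃ U : Subgroup G, IsCompact (U : Set G) ∧ IsOpen (U : Set G) ∧ IsMinimizing α U := by
  obtain ⟨U, ⟨hUc, hUo⟩, hmin⟩ := exists_minimalFor_of_wellFoundedLT
    (fun U : Subgroup G => IsCompact (U : Set G) ∧ IsOpen (U : Set G)) (displacementIndex α) hG
  exact ⟨U, hUc, hUo, fun V hVc hVo => (le_total _ _).elim id (hmin ⟨hVc, hVo⟩)⟩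

variable [IsTopologicalGroup G] [T2Space G]

theorem exists_hasMultiplicativeDisplacement (hα : Continuous α)
    (hG : ∃ U : Subgroup G, IsCompact (U : Set G) ∧ IsOpen (U : Set G)) :
    ∃ U : Subgroup G, IsCompact (U : Set G) ∧ IsOpen (U : Set G) ∧
      HasMultiplicativeDisplacement α U := by
  obtain ⟨U, hUc, hUo, hU⟩ := exists_isMinimizing α hG
  have hc := isCompact_tidyingMonoid hα hUc hUo
  have ho := isOpen_tidyingMonoid hα hUc hUo
  obtain ⟨T, hT⟩ := exists_subgroup_toSubmonoid_eq hc
  rw [← hT] at hc ho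
  exact ⟨T, hc, ho,
    (hU.isTidyAbove hα hUc hUo).hasMultiplicativeDisplacement_of_toSubmonoid_eq hT⟩

theorem IsMinimizing.isTidy (hα : Continuous α) (hUc : IsCompact (U : Set G))
    (hUo : IsOpen (U : Set G)) (hU : IsMinimizing α U) : IsTidy α U := by
  obtain ⟨T, hTc, hTo, hT⟩ := exists_hasMultiplicativeDisplacement hα ⟨U, hUc, hUo⟩
  have hTA := hU.isTidyAbove hα hUc hUo
  exact ⟨hTA,
    (hU.hasMultiplicativeDisplacement hα hTc hTo hT hUc hUo).isTidyBelow hα hUc hUo hTA⟩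

end Minimizing

end TidyEnd

theorem mainTheorem1_general {G : Type*} [Group G] [TopologicalSpace G] [IsTopologicalGroup G]
    [T2Space G] (hG : ∃ U : Subgroup G, IsCompact (U : Set G) ∧ IsOpen (U : Set G))
    (α : G →* G) (hα : Continuous α) :
    (∀ U : Subgroup G, IsCompact (U : Set G) → IsOpen (U : Set G) →
      (TidyEnd.IsMinimizing α U ↔ TidyEnd.IsTidy α U)) ∧
    ∃ U : Subgroup G, IsCompact (U : Set G) ∧ IsOpen (U : Set G) ∧ TidyEnd.IsTidy α U := by
  refine ⟨fun U hUc hUo => ⟨fun h => h.isTidy hα hUc hUo, fun h =>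
    (h.hasMultiplicativeDisplacement hα hUc hUo).isMinimizing hα hUc hUo⟩, ?_⟩
  obtain ⟨U, hUc, hUo, hU⟩ := TidyEnd.exists_isMinimizing α hG
  exact ⟨U, hUc, hUo, hU.isTidy hα hUc hUo⟩

theorem mainTheorem1 {G : Type*} [Group G] [TopologicalSpace G] [IsTopologicalGroup G]
    [LocallyCompactSpace G] [TotallyDisconnectedSpace G] (α : G →* G) (hα : Continuous α) :
    (∀ U : Subgroup G, IsCompact (U : Set G) → IsOpen (U : Set G) →
      (TidyEnd.IsMinimizing α U ↔ TidyEnd.IsTidy α U)) ∧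
    ∃ U : Subgroup G, IsCompact (U : Set G) ∧ IsOpen (U : Set G) ∧ TidyEnd.IsTidy α U :=
  mainTheorem1_general (TidyEnd.exists_isCompact_isOpen_subgroup G) α hα
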